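/- Let $d \ge 0$ be an integer and $[d] = \{1,\dots,d\}$. For $K \subset [d]$ and $A \subset [0,1]^d$, let $[A]_K$ be the set of all $\omega \in [0,1]^d$ such that every $\omega' \in [0,1]^d$ with $\omega'_i = \omega_i$ for all $i \in K$ belongs to $A$. For $A, B \subset [0,1]^d$, define $$A \,\square\, B := \bigcup_{K \subset [d]} [A]_K \cap [B]_{[d] \setminus K}.$$ Let $m_d$ be Lebesgue measure on the Borel subsets of $[0,1]^d$, and let $\lambda_d$ be its completion, defined on the Lebesgue measurable subsets of $[0,1]^d$. Then for all Lebesgue measurable sets $A, B \subset [0,1]^d$ there exists a Borel set $C \subset [0,1]^d$ with $$A \,\square\, B \subset C \qquad\text{and}\qquad m_d(C) \le \lambda_d(A)\,\lambda_d(B).$$ -/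

import Mathlib

open MeasureTheory

/-- The thin cylinder `Cyl(K, ω)`: all points of `S ^ d` that agree with `ω` on the
coordinates in `K`. -/
def thinCylinder {d : ℕ} {S : Type*} (K : Finset (Fin d)) (ω : Fin d → S) :
    Set (Fin d → S) :=
  {ω' | ∀ i ∈ K, ω' i = ω i}

/-- `[A]_K`: the largest cylinder contained in `A` that is free in the directions outside `K`. -/
def maxCylinder {d : ℕ} {S : Type*} (A : Set (Fin d → S)) (K : Finset (Fin d)) :
    Set (Fin d → S) :=
  {ω | thinCylinder K ω ⊆ A}

/-- The van den Berg–Kesten–Reimer combination `A □ B` of `A, B ⊆ S ^ d`: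
the points at which `A` and `B` occur for disjoint reasons. -/
def bkr {d : ℕ} {S : Type*} (A B : Set (Fin d → S)) : Set (Fin d → S) :=
  ⋃ K : Finset (Fin d), maxCylinder A K ∩ maxCylinder B Kᶜ

/-! Discrete case: give each `x ∈ bkr A B`, with a witness `K`, the tensor product of the vectors
`bflyVec`. These are independent mod 2, and their Gram matrix also equals that of the red against
the yellow vectors (`sum_bflyVec_mul`). Red vectors vanish off `A` and yellow ones off the
complemented copy of `B`, so a relation among the red vectors on `Z` makes the same combination of
`bflyVec` tensors have squared norm zero. Hence the red vectors are independent in `Z → ℤ`, which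
bounds the cardinality.

General case: two independent points `x`, `y` span a grid of `2 ^ d` mixtures. Each mixture has law
`μ`, and complementary mixtures are independent, so integrating the discrete inequality over `(x,
y)` gives the result. Since `maxCylinder` of a Borel set may fail to be Borel, `essCylinder`
replaces it: it is measurable by Fubini and contained in the set up to a null set
(`measure_essCylinder_diff`). -/

/-- Four vectors in `ℤ²`, forming two orthogonal bases (indexed by `x`), with the two elements of
each basis indexed by `k`. The bases are at an angle of 45 degrees. -/
def bflyVec (x k z : Bool) : ℤ :=
  if x then (if k then 1 else if z then -1 else 1) else (if z = !k then 1 else 0)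

/-- A vector which is concentrated at `x` if `k` holds. -/
def redVec (x k z : Bool) : ℤ :=
  if k then (if z = x then 1 else 0) else ∑ w, bflyVec x false w * bflyVec (!z) false w

/-- A vector which is concentrated at `!y` if `l` fails. -/
def yellowVec (y l z : Bool) : ℤ :=
  if l then ∑ w, bflyVec z true w * bflyVec y true w else (if z = !y then 1 else 0)

theorem sum_bflyVec_mul (x k y l : Bool) :
    ∑ w, bflyVec x k w * bflyVec y l w = ∑ z, redVec x k z * yellowVec y l z := by
  revert x k y l; decide

/-! ### Tensor powers and Reimer's inequality on the discrete cube. -/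

section Tensor

variable {n : ℕ}

/-- The tensor product of one-coordinate vectors. -/
def tensorVec (f : Bool → Bool → Bool → ℤ) (x k z : Fin n → Bool) : ℤ :=
  ∏ i, f (x i) (k i) (z i)

theorem sum_tensorVec_mul (f g : Bool → Bool → Bool → ℤ) (x k y l : Fin n → Bool) :
    ∑ z, tensorVec f x k z * tensorVec g y l z =
      ∏ i, ∑ w, f (x i) (k i) w * g (y i) (l i) w := by
  simp only [tensorVec, ← Finset.prod_mul_distrib]
  rw [Fintype.prod_sum]

theorem sum_tensorVec_bflyVec_mul (x k y l : Fin n → Bool) :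
    ∑ z, tensorVec bflyVec x k z * tensorVec bflyVec y l z =
      ∑ z, tensorVec redVec x k z * tensorVec yellowVec y l z := by
  simp only [sum_tensorVec_mul, sum_bflyVec_mul]

/-- The indicator of `z ≤ s`. -/
def leVec (s _k z : Bool) : ℤ := if z ≤ s then 1 else 0

/-- With the next lemma, this makes the matrix of pairings with down-sets triangular mod 2, whatever
the choice of `k`. -/
theorem even_sum_bflyVec_mul_leVec (x k s l : Bool) (h : ¬ x ≤ !s) :
    (2 : ℤ) ∣ ∑ w, bflyVec x k w * leVec s l w := by
  revert x k s l; decide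

theorem odd_sum_bflyVec_mul_leVec (x k l : Bool) :
    Odd (∑ w, bflyVec x k w * leVec (!x) l w) := by
  revert x k l; decide

/-- For an arbitrary choice of `k x` for every `x`, the vectors are linearly independent, as their
determinant is odd. -/
theorem linearIndependent_tensorVec_bflyVec (k : (Fin n → Bool) → Fin n → Bool) :
    LinearIndependent ℤ fun x : Fin n → Bool ↦ tensorVec bflyVec x (k x) := by
  set M : Matrix (Fin n → Bool) (Fin n → Bool) ℤ :=
    Matrix.of fun x ↦ tensorVec bflyVec x (k x) with hM
  refine Matrix.linearIndependent_rows_of_det_ne_zero (A := M) fun hdet ↦ ?_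
  have hdet2 : (M.map (Int.castRingHom (ZMod 2))).det = 0 := by
    rw [← RingHom.mapMatrix_apply, ← RingHom.map_det, hdet, map_zero]
  obtain ⟨c, hc0, hc⟩ := Matrix.exists_vecMul_eq_zero_iff.2 hdet2
  obtain ⟨x₀, hx₀, hmin⟩ : ∃ x₀, c x₀ ≠ 0 ∧ ∀ x, c x ≠ 0 → x ≤ x₀ → x = x₀ := by
    have hne : (Finset.univ.filter fun x ↦ c x ≠ 0).Nonempty := by
      obtain ⟨x, hx⟩ := Function.ne_iff.1 hc0
      exact ⟨x, by simpa using hx⟩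
    obtain ⟨x₀, h⟩ := Finset.exists_minimal hne
    refine ⟨x₀, by simpa using h.prop, fun x hx hle ↦ le_antisymm hle ?_⟩
    exact h.le_of_le (by simpa using hx) hle
  -- Mod 2, pairing with the indicator of `{z | z ≤ s}` kills every `x` not below `x₀`; minimality
  -- kills those strictly below, so only the odd term at `x₀` survives.
  let s : Fin n → Bool := fun i ↦ !x₀ i
  have key : ∑ x, c x * ((∑ z, tensorVec bflyVec x (k x) z * tensorVec leVec s s z : ℤ) : ZMod 2)
      = 0 := by
    have : ∑ z, (∑ x, c x * (tensorVec bflyVec x (k x) z : ZMod 2)) *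
        (tensorVec leVec s s z : ZMod 2) = 0 := by
      refine Finset.sum_eq_zero fun z _ ↦ ?_
      have := congrFun hc z
      simp only [Matrix.vecMul, dotProduct, Matrix.map_apply, hM, Matrix.of_apply,
        Int.coe_castRingHom, Pi.zero_apply] at this
      rw [this, zero_mul]
    rw [← this]
    simp only [Finset.sum_mul, Int.cast_sum, Int.cast_mul, Finset.mul_sum, mul_assoc]
    exact Finset.sum_comm
  rw [Finset.sum_eq_single x₀] at key
  · rw [sum_tensorVec_mul, Int.cast_prod] at key
    rcases mul_eq_zero.1 key with h | h
    · exact hx₀ h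
    · obtain ⟨i, -, hi⟩ := Finset.prod_eq_zero_iff.1 h
      have hodd := odd_sum_bflyVec_mul_leVec (x₀ i) (k x₀ i) (s i)
      rw [← Int.not_even_iff_odd] at hodd
      exact hodd ((even_iff_two_dvd).2 ((ZMod.intCast_zmod_eq_zero_iff_dvd _ 2).1 hi))
  · intro x _ hx
    by_cases hcx : c x = 0
    · rw [hcx, zero_mul]
    · have : ¬ x ≤ x₀ := fun h ↦ hx (hmin x hcx h)
      obtain ⟨i, hi⟩ := not_forall.1 this
      rw [sum_tensorVec_mul, Int.cast_prod, Finset.prod_eq_zero (Finset.mem_univ i), mul_zero]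
      refine (ZMod.intCast_zmod_eq_zero_iff_dvd _ 2).2
        (even_sum_bflyVec_mul_leVec _ _ _ _ ?_)
      simpa [s] using hi
  · simp

/-- **Reimer's inequality**, in its form on the discrete cube. -/
theorem ncard_bkr_le (A B : Set (Fin n → Bool)) :
    (bkr A B).ncard ≤ {z | z ∈ A ∧ (fun i ↦ !z i) ∈ B}.ncard := by
  classical
  set Z : Set (Fin n → Bool) := {z | z ∈ A ∧ (fun i ↦ !z i) ∈ B}
  have hK : ∀ x : Fin n → Bool, ∃ K : Finset (Fin n),
      x ∈ bkr A B → x ∈ maxCylinder A K ∧ x ∈ maxCylinder B Kᶜ := fun x ↦ by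
    by_cases hx : x ∈ bkr A B
    · obtain ⟨K, hK⟩ := Set.mem_iUnion.1 hx
      exact ⟨K, fun _ ↦ hK⟩
    · exact ⟨∅, fun h ↦ absurd h hx⟩
  choose K hK using hK
  let k : (Fin n → Bool) → Fin n → Bool := fun x i ↦ decide (i ∈ K x)
  have hred : ∀ x ∈ bkr A B, ∀ z ∉ A, tensorVec redVec x (k x) z = 0 := by
    intro x hx z hz
    have : z ∉ thinCylinder (K x) x := fun h ↦ hz ((hK x hx).1 h)
    simp only [thinCylinder, Set.mem_ofPred_eq, not_forall] at this
    obtain ⟨i, hi, hne⟩ := this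
    exact Finset.prod_eq_zero (Finset.mem_univ i) (by simp [redVec, k, hi, hne])
  have hyel : ∀ y ∈ bkr A B, ∀ z, (fun i ↦ !z i) ∉ B → tensorVec yellowVec y (k y) z = 0 := by
    intro y hy z hz
    have : (fun i ↦ !z i) ∉ thinCylinder (K y)ᶜ y := fun h ↦ hz ((hK y hy).2 h)
    simp only [thinCylinder, Set.mem_ofPred_eq, not_forall, Finset.mem_compl] at this
    obtain ⟨i, hi, hne⟩ := this
    refine Finset.prod_eq_zero (Finset.mem_univ i) ?_
    have : z i ≠ !y i := fun h ↦ hne (by simp [h])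
    simp [yellowVec, k, hi, this]
  have hind : LinearIndependent ℤ
      fun (x : bkr A B) (z : Z) ↦ tensorVec redVec x.1 (k x.1) z.1 := by
    refine Fintype.linearIndependent_iff.2 fun c hc ↦ ?_
    refine Fintype.linearIndependent_iff.1 ((linearIndependent_tensorVec_bflyVec k).comp
      (Subtype.val : bkr A B → _) Subtype.val_injective) c ?_
    have hmul : ∀ f g : Bool → Bool → Bool → ℤ,
        ∑ z, (∑ x : bkr A B, c x * tensorVec f x.1 (k x.1) z) *
          (∑ y : bkr A B, c y * tensorVec g y.1 (k y.1) z) =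
        ∑ x : bkr A B, ∑ y : bkr A B, c x * c y *
          ∑ z, tensorVec f x.1 (k x.1) z * tensorVec g y.1 (k y.1) z := by
      intro f g
      simp only [Finset.sum_mul_sum]
      rw [Finset.sum_comm]
      refine Finset.sum_congr rfl fun x _ ↦ ?_
      rw [Finset.sum_comm]
      refine Finset.sum_congr rfl fun y _ ↦ ?_
      rw [Finset.mul_sum]
      exact Finset.sum_congr rfl fun z _ ↦ by ring
    -- The squared norm may be computed with red and yellow vectors: on `Z` the red factor vanishes
    -- by `hc`, and off `Z` one factor vanishes by `hred` or `hyel`.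
    have hzero : ∑ z, (∑ x : bkr A B, c x * tensorVec bflyVec x.1 (k x.1) z) *
          (∑ y : bkr A B, c y * tensorVec bflyVec y.1 (k y.1) z) = 0 := by
      rw [hmul]
      simp only [sum_tensorVec_bflyVec_mul]
      rw [← hmul]
      refine Finset.sum_eq_zero fun z _ ↦ ?_
      by_cases hzA : z ∈ A
      · by_cases hzB : (fun i ↦ !z i) ∈ B
        · have := congrFun hc ⟨z, hzA, hzB⟩
          simp only [Finset.sum_apply, Pi.smul_apply, smul_eq_mul, Pi.zero_apply] at this
          rw [this, zero_mul]
        · exact mul_eq_zero_of_right _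
            (Finset.sum_eq_zero fun y _ ↦ by rw [hyel y.1 y.2 z hzB, mul_zero])
      · exact mul_eq_zero_of_left
          (Finset.sum_eq_zero fun x _ ↦ by rw [hred x.1 x.2 z hzA, mul_zero]) _
    rw [Finset.sum_eq_zero_iff_of_nonneg fun z _ ↦ mul_self_nonneg _] at hzero
    ext z
    simpa using hzero z (Finset.mem_univ z)
  have hcard := hind.fintype_card_le_finrank
  rwa [Module.finrank_fintype_fun_eq_card, ← Nat.card_eq_fintype_card,
    ← Nat.card_eq_fintype_card, Nat.card_coe_set_eq, Nat.card_coe_set_eq] at hcard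

end Tensor

/-! ### Mixing coordinates of independent points; essential cylinders. -/

section Mix

variable {ι S : Type*} [DecidableEq ι]

/-- The point with the coordinates of `x` on `K`, and those of `y` elsewhere. -/
def mix (K : Finset ι) (x y : ι → S) : ι → S := fun i ↦ if i ∈ K then x i else y i

variable [MeasurableSpace S]

theorem measurable_mix (K : Finset ι) :
    Measurable fun p : (ι → S) × (ι → S) ↦ mix K p.1 p.2 := by
  refine measurable_pi_lambda _ fun i ↦ ?_
  by_cases h : i ∈ K <;> simp only [mix, h, if_true, if_false] <;> fun_prop

/-- The points at which `A` occurs for almost all values of the coordinates outside `K`. -/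
def essCylinder (μ : Measure (ι → S)) (A : Set (ι → S)) (K : Finset ι) : Set (ι → S) :=
  {x | ∀ᵐ y ∂μ, mix K x y ∈ A}

theorem measurableSet_essCylinder (μ : Measure (ι → S)) [SFinite μ] {A : Set (ι → S)}
    (hA : MeasurableSet A) (K : Finset ι) : MeasurableSet (essCylinder μ A K) := by
  have := measurable_measure_prodMk_left (ν := μ) (measurable_mix K hA.compl)
  exact this (measurableSet_singleton 0)

theorem mem_essCylinder_congr {μ : Measure (ι → S)} {A : Set (ι → S)} {K : Finset ι}
    {x y : ι → S} (h : ∀ i ∈ K, x i = y i) : x ∈ essCylinder μ A K ↔ y ∈ essCylinder μ A K := by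
  have : mix K x = mix K y := by
    funext z i
    by_cases hi : i ∈ K <;> simp [mix, hi, h]
  simp [essCylinder, this]

variable [Fintype ι]

/-- Exchanging some of the coordinates of two independent points preserves the measure. -/
theorem measurePreserving_mix_mix (μ : ι → Measure S) [∀ i, SigmaFinite (μ i)] (K : Finset ι) :
    MeasurePreserving (fun p : (ι → S) × (ι → S) ↦ (mix K p.1 p.2, mix K p.2 p.1))
      ((Measure.pi μ).prod (Measure.pi μ)) ((Measure.pi μ).prod (Measure.pi μ)) := by
  have he := measurePreserving_arrowProdEquivProdArrow S S ι μ μ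
  have hs := measurePreserving_pi (fun i ↦ (μ i).prod (μ i)) (fun i ↦ (μ i).prod (μ i))
    (f := fun i ↦ if i ∈ K then id else Prod.swap) (fun i ↦ by
      by_cases h : i ∈ K
      · simpa [h] using MeasurePreserving.id _
      · simpa [h] using Measure.measurePreserving_swap)
  convert! he.comp (hs.comp he.symm) using 1
  funext p
  refine Prod.ext ?_ ?_ <;> funext i <;> by_cases h : i ∈ K <;>
    simp [mix, h, MeasurableEquiv.arrowProdEquivProdArrow, Equiv.arrowProdEquivProdArrow]

theorem measurePreserving_mix (μ : ι → Measure S) [∀ i, IsProbabilityMeasure (μ i)]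
    (K : Finset ι) :
    MeasurePreserving (fun p : (ι → S) × (ι → S) ↦ mix K p.1 p.2)
      ((Measure.pi μ).prod (Measure.pi μ)) (Measure.pi μ) :=
  measurePreserving_fst.comp (measurePreserving_mix_mix μ K)

/-- Resample the coordinates outside `K`: this preserves the law and membership in the essential
cylinder, and from a point of that cylinder it almost surely lands in `A`. -/
theorem measure_essCylinder_diff (μ : ι → Measure S) [∀ i, IsProbabilityMeasure (μ i)]
    {A : Set (ι → S)} (hA : MeasurableSet A) (K : Finset ι) :
    Measure.pi μ (essCylinder (Measure.pi μ) A K \ A) = 0 := by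
  have hE := (measurableSet_essCylinder (Measure.pi μ) hA K).diff hA
  have hp := measurePreserving_mix μ K
  rw [← hp.measure_preimage hE.nullMeasurableSet, Measure.measure_prod_null (hp.measurable hE)]
  refine Filter.Eventually.of_forall fun x ↦ ?_
  by_cases hx : x ∈ essCylinder (Measure.pi μ) A K
  · refine measure_mono_null (fun y hy ↦ ?_) hx
    exact hy.2
  · convert! measure_empty (μ := Measure.pi μ)
    refine Set.eq_empty_of_forall_notMem fun y hy ↦ hx ?_
    exact (mem_essCylinder_congr fun i hi ↦ by simp [mix, hi]).1 hy.1

end Mix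

/-! ### From the discrete cube to product measures. -/

section Main

variable {d : ℕ} {S : Type*}

/-- The coordinates at which `s` is true. -/
def trueCoords (s : Fin d → Bool) : Finset (Fin d) := Finset.univ.filter fun i ↦ s i = true

theorem mix_trueCoords_not (s : Fin d → Bool) (x y : Fin d → S) :
    mix (trueCoords fun i ↦ !s i) x y = mix (trueCoords s) y x := by
  funext i
  cases h : s i <;> simp [mix, trueCoords, h]

variable [MeasurableSpace S]

theorem maxCylinder_subset_essCylinder (μ : Measure (Fin d → S)) {A A' : Set (Fin d → S)}
    (h : A ⊆ A') (K : Finset (Fin d)) : maxCylinder A K ⊆ essCylinder μ A' K := by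
  intro x hx
  have hmem : ∀ y, mix K x y ∈ thinCylinder K x := fun y i hi ↦ by simp [mix, hi]
  have hae : ∀ᵐ y ∂μ, mix K x y ∈ A' := Filter.Eventually.of_forall fun y ↦ h (hx (hmem y))
  exact hae

/-- The essential version of `bkr`. -/
def essBkr (μ : Measure (Fin d → S)) (A B : Set (Fin d → S)) : Set (Fin d → S) :=
  ⋃ K : Finset (Fin d), essCylinder μ A K ∩ essCylinder μ B Kᶜ

theorem measurableSet_essBkr (μ : Measure (Fin d → S)) [SFinite μ] {A B : Set (Fin d → S)}
    (hA : MeasurableSet A) (hB : MeasurableSet B) : MeasurableSet (essBkr μ A B) :=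
  MeasurableSet.iUnion fun K ↦
    (measurableSet_essCylinder μ hA K).inter (measurableSet_essCylinder μ hB Kᶜ)

/-- Changing `s` outside `K` keeps the mixture in the essential cylinder, hence in the set itself,
because no point of the grid is exceptional. -/
theorem preimage_essBkr_subset {μ : Measure (Fin d → S)} {A B : Set (Fin d → S)}
    {x y : Fin d → S}
    (hA : ∀ s K, mix (trueCoords s) x y ∉ essCylinder μ A K \ A)
    (hB : ∀ s K, mix (trueCoords s) x y ∉ essCylinder μ B K \ B) :
    {s | mix (trueCoords s) x y ∈ essBkr μ A B} ⊆
      bkr {s | mix (trueCoords s) x y ∈ A} {s | mix (trueCoords s) x y ∈ B} := by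
  have key : ∀ C : Set (Fin d → S),
      (∀ s K, mix (trueCoords s) x y ∉ essCylinder μ C K \ C) → ∀ s K,
      mix (trueCoords s) x y ∈ essCylinder μ C K →
      s ∈ maxCylinder {s | mix (trueCoords s) x y ∈ C} K := by
    intro C hC s K hs t ht
    by_contra hn
    refine hC t K ⟨(mem_essCylinder_congr fun i hi ↦ ?_).1 hs, hn⟩
    simp [mix, trueCoords, ht i hi]
  intro s hs
  obtain ⟨K, h1, h2⟩ := Set.mem_iUnion.1 hs
  exact Set.mem_iUnion.2 ⟨K, key A hA s K h1, key B hB s Kᶜ h2⟩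

/-- The **van den Berg–Kesten–Reimer inequality** for the essential version of `bkr`. -/
theorem measure_essBkr_le (ν : Fin d → Measure S) [∀ i, IsProbabilityMeasure (ν i)]
    {A B : Set (Fin d → S)} (hA : MeasurableSet A) (hB : MeasurableSet B) :
    Measure.pi ν (essBkr (Measure.pi ν) A B) ≤ Measure.pi ν A * Measure.pi ν B := by
  classical
  set μ := Measure.pi ν
  have hC := measurableSet_essBkr μ hA hB
  have hae : ∀ E : Set (Fin d → S), MeasurableSet E →
      ∀ᵐ p ∂μ.prod μ, ∀ s K, mix (trueCoords s) p.1 p.2 ∉ essCylinder μ E K \ E := by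
    intro E hE
    refine ae_all_iff.2 fun s ↦ ae_all_iff.2 fun K ↦ ?_
    exact (measurePreserving_mix ν (trueCoords s)).quasiMeasurePreserving.ae
      (measure_eq_zero_iff_ae_notMem.1 (measure_essCylinder_diff ν hE K))
  have hCm : ∀ s : Fin d → Bool, MeasurableSet {p : (Fin d → S) × (Fin d → S) |
      mix (trueCoords s) p.1 p.2 ∈ essBkr μ A B} := fun s ↦ measurable_mix (trueCoords s) hC
  have hleft : ∀ s : Fin d → Bool,
      ∫⁻ p, {p : (Fin d → S) × (Fin d → S) | mix (trueCoords s) p.1 p.2 ∈ essBkr μ A B}.indicator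
        1 p ∂μ.prod μ = μ (essBkr μ A B) := fun s ↦ by
    have hp := measurePreserving_mix ν (trueCoords s)
    rw [lintegral_indicator_one (hCm s)]
    exact hp.measure_preimage hC.nullMeasurableSet
  have hAB : ∀ s : Fin d → Bool, MeasurableSet {p : (Fin d → S) × (Fin d → S) |
      mix (trueCoords s) p.1 p.2 ∈ A ∧ mix (trueCoords fun i ↦ !s i) p.1 p.2 ∈ B} := fun s ↦
    (measurable_mix (trueCoords s) hA).inter (measurable_mix (trueCoords fun i ↦ !s i) hB)
  -- The two complementary mixtures form an independent pair, by `measurePreserving_mix_mix`.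
  have hright : ∀ s : Fin d → Bool,
      ∫⁻ p, {p : (Fin d → S) × (Fin d → S) | mix (trueCoords s) p.1 p.2 ∈ A ∧
        mix (trueCoords fun i ↦ !s i) p.1 p.2 ∈ B}.indicator 1 p ∂μ.prod μ = μ A * μ B := fun s ↦ by
    have hp := measurePreserving_mix_mix ν (trueCoords s)
    rw [lintegral_indicator_one (hAB s), ← Measure.prod_prod A B,
      ← hp.measure_preimage (hA.prod hB).nullMeasurableSet]
    simp only [mix_trueCoords_not]
    rfl
  have hcard : ∀ (T : Set (Fin d → Bool)),
      (T.ncard : ENNReal) = ∑ s, if s ∈ T then 1 else 0 := fun T ↦ by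
    rw [Finset.sum_boole, Set.ncard_eq_toFinset_card']
    congr 2
    ext; simp
  have hsum : ∑ _s : Fin d → Bool, μ (essBkr μ A B) ≤ ∑ _s : Fin d → Bool, μ A * μ B := by
    rw [← Finset.sum_congr rfl fun s _ ↦ hleft s, ← Finset.sum_congr rfl fun s _ ↦ hright s,
      ← lintegral_finsetSum _ fun s _ ↦ measurable_one.indicator (hCm s),
      ← lintegral_finsetSum _ fun s _ ↦ measurable_one.indicator (hAB s)]
    -- For almost every `p`, the integrands count points of the cube, and the discrete inequality
    -- compares them.
    refine lintegral_mono_ae ?_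
    filter_upwards [hae A hA, hae B hB] with p hpA hpB
    have h := (Set.ncard_le_ncard (preimage_essBkr_subset hpA hpB)).trans (ncard_bkr_le _ _)
    have h' : (Set.ncard _ : ENNReal) ≤ (Set.ncard _ : ENNReal) := Nat.cast_le.2 h
    rw [hcard, hcard] at h'
    simp only [Set.mem_ofPred_eq] at h'
    convert! h' using 2
  rw [Finset.sum_const, Finset.sum_const, nsmul_eq_mul, nsmul_eq_mul] at hsum
  exact (ENNReal.mul_le_mul_iff_right (by simp) (by simp)).1 hsum

end Main

theorem mainTheorem6 (d : ℕ) (A B : Set (Fin d → unitInterval))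
    (hA : NullMeasurableSet A (volume : Measure (Fin d → unitInterval)))
    (hB : NullMeasurableSet B (volume : Measure (Fin d → unitInterval))) :
    ∃ C : Set (Fin d → unitInterval), MeasurableSet C ∧ bkr A B ⊆ C ∧
      (volume : Measure (Fin d → unitInterval)) C ≤
        (volume : Measure (Fin d → unitInterval)) A *
          (volume : Measure (Fin d → unitInterval)) B := by
  have hA' := measurableSet_toMeasurable (volume : Measure (Fin d → unitInterval)) A
  have hB' := measurableSet_toMeasurable (volume : Measure (Fin d → unitInterval)) B
  refine ⟨_, measurableSet_essBkr volume hA' hB', ?_, ?_⟩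
  · exact Set.iUnion_mono fun K ↦ Set.inter_subset_inter
      (maxCylinder_subset_essCylinder _ (subset_toMeasurable _ _) K)
      (maxCylinder_subset_essCylinder _ (subset_toMeasurable _ _) Kᶜ)
  · rw [← measure_toMeasurable A, ← measure_toMeasurable B]
    exact measure_essBkr_le (fun _ ↦ volume) hA' hB'
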